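/- Let $\mathbb{F}$ be a field, let $V$ be an infinite-dimensional vector space over $\mathbb{F}$, and let $p_1,p_2,p_3 \in \mathbb{F}[t]$ be polynomials of degree $2$ that split over $\mathbb{F}$. An endomorphism $u$ of $V$ is called a $(p_1,p_2,p_3)$-sum if there are endomorphisms $a_1,a_2,a_3$ of $V$ such that $u=a_1+a_2+a_3$ and $p_k(a_k)=0$ for all $k\in\{1,2,3\}$. A scalar $\lambda\in\mathbb{F}$ is called a $(p_1,p_2,p_3)$-sum if there are $x_1,x_2,x_3\in\mathbb{F}$ such that $\lambda=x_1+x_2+x_3$ and $p_k(x_k)=0$ for all $k\in\{1,2,3\}$. A scalar $\lambda$ is called a dominant eigenvalue of an endomorphism $u$ of $V$ if $\operatorname{rk}(u-\lambda\,\mathrm{id}_V)<\dim V$, as cardinals. The trace $\operatorname{tr} p$ of a polynomial $p$ of degree $n\geq 1$ with leading coefficient $\alpha$ is the opposite of the coefficient of $\alpha^{-1}p$ on $t^{n-1}$. Theorem. Let $u$ be an endomorphism of $V$ with a dominant eigenvalue $\lambda$ such that $u-\lambda\,\mathrm{id}_V$ has infinite rank. Assume that $\lambda$ is a $(p_1,p_2,p_3)$-sum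 or that $2\lambda=\operatorname{tr} p_1+\operatorname{tr} p_2+\operatorname{tr} p_3$. Then $u$ is a $(p_1,p_2,p_3)$-sum. -/

import Mathlib

open Polynomial

/-- An endomorphism `u` of `V` is a `(p₁, …, pₙ)`-sum if there are endomorphisms `a₁, …, aₙ` of `V`
with `u = a₁ + ⋯ + aₙ` and `pₖ(aₖ) = 0` for every `k`. -/
def IsEndSum {F : Type*} {V : Type*} [Field F] [AddCommGroup V] [Module F V] {n : ℕ}
    (p : Fin n → F[X]) (u : Module.End F V) : Prop :=
  ∃ a : Fin n → Module.End F V, u = ∑ k, a k ∧ ∀ k, aeval (a k) (p k) = 0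

/-- A scalar `l` is a `(p₁, …, pₙ)`-sum if there are scalars `x₁, …, xₙ`
with `l = x₁ + ⋯ + xₙ` and `pₖ(xₖ) = 0` for every `k`. -/
def IsScalarSum {F : Type*} [Field F] {n : ℕ} (p : Fin n → F[X]) (l : F) : Prop :=
  ∃ x : Fin n → F, l = ∑ k, x k ∧ ∀ k, (p k).eval (x k) = 0

/-- `l` is a dominant eigenvalue of `u` if `rk (u - l id) < dim V`, as cardinals. -/
def IsDominantEigenvalue {F : Type*} {V : Type*} [Field F] [AddCommGroup V] [Module F V]
    (u : Module.End F V) (l : F) : Prop :=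
  LinearMap.rank (u - l • LinearMap.id) < Module.rank F V

/-- The trace of a nonconstant polynomial of degree `n` with leading coefficient `α`: the opposite
of the coefficient on `t ^ (n - 1)` of the monic polynomial `α⁻¹ p`. -/
noncomputable def polyTrace {F : Type*} [Field F] (p : F[X]) : F :=
  -(C p.leadingCoeff⁻¹ * p).coeff (p.natDegree - 1)

/-! Put `n = u - l`. As its rank is infinite and below `dim V`, `exists_isCompl_of_rank_lt` gives `V
= A ⊕ B` with `A` stable under `n`, `B` infinite-dimensional and killed by `n`. On `B`, `u` is the
scalar `l`: either three scalars do, or `B` is a square `N × N` and the trace condition allows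
two-by-two matrices.

On `A` there are `dim A` vectors `x i` such that the `x i` and `n (x i)` are independent. This
leaves room for a quadratic `a₁` such that `n - a₁` moves each basis vector injectively to a higher
one, up to lower terms. By `exists_linearEquiv_shift_of_basis` such a map is a direct sum of shifts
with any chosen diagonal weights. With alternating weights, `exists_add_of_shift` splits it in two:
one summand carries the arrows leaving even positions, the other those leaving odd positions. -/

/-! ### Transfinite choice of distinct upper bounds -/

/-- A family of subsets of an infinite type, indexed by the type itself and with small
complements, has an injective choice function. -/
theorem exists_injective_mem_of_mk_compl_lt {I : Type*} [Infinite I] (S : I → Set I)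
    (hS : ∀ i, Cardinal.mk ↥(S i)ᶜ < Cardinal.mk I) :
    ∃ f : I → I, Function.Injective f ∧ ∀ i, f i ∈ S i := by
  -- In a well-order of minimal type, initial segments are smaller than `I`, so `(S i)ᶜ` and the
  -- earlier values never cover `I`.
  obtain ⟨_, wf, hr⟩ := Cardinal.exists_ord_eq_type_lt I
  have small : ∀ (i : I) (g : ∀ k, k < i → I), ∃ y, y ∈ S i ∧ ∀ k (h : k < i), g k h ≠ y := by
    intro i g
    by_contra! hcon
    have hcov : (Set.univ : Set I) ⊆
        (S i)ᶜ ∪ Set.range (fun k : {k // k < i} => g k.1 k.2) := by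
      intro y _
      by_cases hy : y ∈ S i
      · obtain ⟨k, h, e⟩ := hcon y hy
        exact Or.inr ⟨⟨k, h⟩, e⟩
      · exact Or.inl hy
    have h1 := (Cardinal.mk_le_mk_of_subset hcov).trans (Cardinal.mk_union_le _ _)
    have h2 : Cardinal.mk (Set.range (fun k : {k // k < i} => g k.1 k.2)) < Cardinal.mk I :=
      Cardinal.mk_range_le.trans_lt (Cardinal.mk_Iio_lt i hr)
    rw [Cardinal.mk_univ] at h1
    exact absurd (Cardinal.add_lt_of_lt (Cardinal.aleph0_le_mk I) (hS i) h2) (not_lt.mpr h1)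
  let f : I → I := wf.wf.fix (fun i g => (small i g).choose)
  have hf : ∀ i, f i ∈ S i ∧ ∀ k, k < i → f k ≠ f i := by
    intro i
    have e : f i = (small i (fun k _ => f k)).choose := wf.wf.fix_eq _ i
    rw [e]
    exact (small i (fun k _ => f k)).choose_spec
  refine ⟨f, fun i j hij => ?_, fun i => (hf i).1⟩
  rcases lt_trichotomy i j with h | h | h
  · exact absurd hij ((hf j).2 i h)
  · exact h
  · exact absurd hij.symm ((hf i).2 j h)

/-- On an infinite type `I` there is a well-order such that any family, of size at most that of
`I`, of finite subsets of `I` has pairwise distinct strict upper bounds. -/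
theorem exists_wellOrder_injective_upperBounds {I J : Type*} [Infinite I]
    (j : J ↪ I) :
    ∃ (_ : LinearOrder I) (_ : WellFoundedLT I), ∀ A : J → Finset I,
      ∃ f : J → I, Function.Injective f ∧ ∀ j, ∀ i ∈ A j, i < f j := by
  classical
  obtain ⟨lo, wf, hr⟩ := Cardinal.exists_ord_eq_type_lt I
  refine ⟨lo, wf, fun A => ?_⟩
  have hmk : ∀ a : I, Cardinal.mk (Set.Iic a) < Cardinal.mk I := by
    intro a
    rw [← Set.Iio_insert]
    refine (Cardinal.mk_insert_le).trans_lt ?_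
    refine Cardinal.add_lt_of_lt (Cardinal.aleph0_le_mk I)
      (Cardinal.mk_Iio_lt a hr) ?_
    exact Cardinal.one_lt_aleph0.trans_le (Cardinal.aleph0_le_mk I)
  have hfin : ∀ B : Finset I, Cardinal.mk ({y | ∀ i ∈ B, i < y}ᶜ : Set I) < Cardinal.mk I := by
    intro B
    induction B using Finset.induction_on with
    | empty => simpa using (Cardinal.aleph0_pos).trans_le (Cardinal.aleph0_le_mk I)
    | insert a B _ ih =>
      refine (Cardinal.mk_le_mk_of_subset (t := Set.Iic a ∪ {y | ∀ i ∈ B, i < y}ᶜ) ?_).trans_lt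
        ((Cardinal.mk_union_le _ _).trans_lt
          (Cardinal.add_lt_of_lt (Cardinal.aleph0_le_mk I) (hmk a) ih))
      intro y hy
      by_cases h : y ≤ a
      · exact Or.inl h
      · refine Or.inr fun h' => hy ?_
        intro i hi
        rcases Finset.mem_insert.mp hi with rfl | hi
        · exact not_le.mp h
        · exact h' i hi
  obtain ⟨f, hf, hfm⟩ := exists_injective_mem_of_mk_compl_lt
    (fun i => {y | ∀ k ∈ Function.extend j A (fun _ => ∅) i, k < y}) (fun i => hfin _)
  refine ⟨f ∘ j, hf.comp j.injective, fun k i hi => hfm (j k) i ?_⟩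
  rwa [j.injective.extend_apply]

/-! ### Shifts and their quadratic decompositions -/

/-- A linearly independent family in a vector space is part of a basis. -/
theorem LinearIndependent.exists_basis_sum {F : Type*} {V : Type*} [Field F] [AddCommGroup V]
    [Module F V] {ι : Type*} {v : ι → V} (hv : LinearIndependent F v) :
    ∃ (s : Set V) (b : Module.Basis (ι ⊕ s) F V), ∀ i, b (Sum.inl i) = v i := by
  refine ⟨_, Module.Basis.sumExtend hv, fun i => ?_⟩
  simp [Module.Basis.sumExtend, Trans.trans]
  rfl

/-- If an endomorphism `v` sends each vector `b i` of a basis to `b (s i)`, up to a combination of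
vectors of the basis that are smaller than `b (s i)`, where `s` is injective and increasing for a
well-founded relation, then `v` acts on `V` as a direct sum of copies of a shift with arbitrarily
prescribed weights `θ` on the diagonal. -/
theorem exists_linearEquiv_shift_of_basis {F : Type*} {V : Type*} [Field F] [AddCommGroup V]
    [Module F V] {ι : Type*} (b : Module.Basis ι F V) (v : Module.End F V) {r : ι → ι → Prop}
    (hr : WellFounded r) (s : ι → ι) (hs : Function.Injective s) (hlt : ∀ i, r i (s i))
    (hlow : ∀ i, ∀ k ∈ (b.repr (v (b i) - b (s i))).support, r k (s i)) (θ : ℕ → F) :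
    ∃ e : ({i // i ∉ Set.range s} × ℕ →₀ F) ≃ₗ[F] V, ∀ g n,
      v (e (Finsupp.single (g, n) 1)) =
        e (Finsupp.single (g, n + 1) 1) + θ n • e (Finsupp.single (g, n) 1) := by
  classical
  let G := {i // i ∉ Set.range s}
  let T : Module.End F (G × ℕ →₀ F) := Finsupp.linearCombination F
    (fun p => Finsupp.single (p.1, p.2 + 1) 1 + θ p.2 • Finsupp.single p 1)
  have hT : ∀ g n, T (Finsupp.single (g, n) 1) =
      Finsupp.single (g, n + 1) 1 + θ n • Finsupp.single (g, n) 1 := by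
    intro g n
    simp [T]
  let c : G → ℕ → V := fun g n => Nat.rec (b g) (fun n w => v w - θ n • w) n
  let ψ : (G × ℕ →₀ F) →ₗ[F] V := Finsupp.linearCombination F (fun p => c p.1 p.2)
  have hψ : ∀ g n, ψ (Finsupp.single (g, n) 1) = c g n := by
    intro g n
    simp [ψ]
  have hc : ∀ g n, c g (n + 1) = v (c g n) - θ n • c g n := fun g n => rfl
  have hψT : ∀ m, ψ (T m) = v (ψ m) := by
    intro m
    have : ψ ∘ₗ T = v ∘ₗ ψ := by
      ext ⟨g, n⟩
      simp only [LinearMap.comp_apply, Finsupp.lsingle_apply, hT, map_add, map_smul, hψ, hc]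
      abel
    exact LinearMap.congr_fun this m
  -- The inverse `φ` of `ψ` must intertwine `v` and `T`, which forces its value at `b (s i)` from
  -- those at smaller vectors. By `hlow`, the default `0` is never used there.
  let step : ∀ k, (∀ m, r m k → (G × ℕ →₀ F)) → (G × ℕ →₀ F) := fun k f =>
    if h : k ∈ Set.range s then
      T (f h.choose (by have := hlt h.choose; rwa [h.choose_spec] at this)) -
        (b.repr (v (b h.choose) - b k)).sum
          (fun m a => a • if hm : r m k then f m hm else 0)
    else Finsupp.single (⟨k, h⟩, 0) 1
  let f : ι → (G × ℕ →₀ F) := hr.fix step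
  have hf : ∀ k, f k = step k (fun m _ => f m) := fun k => hr.fix_eq step k
  let φ : V →ₗ[F] (G × ℕ →₀ F) := b.constr F f
  have hφb : ∀ k, φ (b k) = f k := fun k => b.constr_basis F f k
  have hφG : ∀ g : G, φ (b g) = Finsupp.single (g, 0) 1 := by
    intro g
    rw [hφb, hf]
    simp only [step, dif_neg g.2]
    rfl
  have hφs : ∀ i, φ (b (s i)) = T (φ (b i)) - φ (v (b i) - b (s i)) := by
    intro i
    have h : s i ∈ Set.range s := ⟨i, rfl⟩
    have hi : h.choose = i := hs h.choose_spec
    rw [hφb (s i), hf]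
    simp only [step, dif_pos h, hi]
    rw [hφb i]
    congr 1
    rw [show φ (v (b i) - b (s i)) = (b.repr (v (b i) - b (s i))).sum (fun m a => a • f m) from
      b.constr_apply F f _]
    refine Finsupp.sum_congr fun m hm => ?_
    rw [dif_pos (hlow i m hm)]
  have hφT : ∀ w, φ (v w) = T (φ w) := by
    intro w
    have : φ ∘ₗ v = T ∘ₗ φ := by
      refine b.ext fun i => ?_
      have := hφs i
      rw [map_sub] at this
      simp only [LinearMap.comp_apply]
      exact (add_sub_cancel _ _).symm.trans (eq_sub_iff_add_eq.mp this)
    exact LinearMap.congr_fun this w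
  have hφψ : φ ∘ₗ ψ = LinearMap.id := by
    ext1 ⟨g, n⟩
    ext1
    simp only [LinearMap.comp_apply, Finsupp.lsingle_apply, hψ, LinearMap.id_apply]
    induction n with
    | zero => exact hφG g
    | succ n ih => rw [hc, map_sub, hφT, map_smul, ih, hT, add_sub_cancel_right]
  have hψφ : ψ ∘ₗ φ = LinearMap.id := by
    refine b.ext fun k => ?_
    simp only [LinearMap.comp_apply, LinearMap.id_apply]
    induction k using hr.induction with
    | _ k ih =>
    by_cases h : k ∈ Set.range s
    · obtain ⟨i, rfl⟩ := h
      have hl : ∀ w : V, (∀ m ∈ (b.repr w).support, r m (s i)) → ψ (φ w) = w := by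
        intro w hw
        conv_lhs => rw [← b.linearCombination_repr w]
        conv_rhs => rw [← b.linearCombination_repr w]
        simp only [Finsupp.linearCombination_apply, map_finsuppSum, map_smul]
        exact Finsupp.sum_congr fun m hm => by rw [ih m (hw m hm)]
      rw [hφs, map_sub, hψT, ih i (hlt i), hl _ (hlow i), sub_sub_cancel]
    · rw [hφG ⟨k, h⟩, hψ]
      rfl
  let e : (G × ℕ →₀ F) ≃ₗ[F] V := LinearEquiv.ofLinearMap ψ φ hψφ hφψ
  refine ⟨e, fun g n => ?_⟩
  have he : ∀ m, e m = ψ m := fun m => rfl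
  rw [he, he, hψ, hψ, hc, sub_add_cancel]

/-- A direct sum of copies of a shift, with suitable weights on the diagonal, is the sum of two
endomorphisms annihilated by prescribed split polynomials of degree two. -/
theorem exists_add_of_shift {F : Type*} {V : Type*} [Field F] [AddCommGroup V] [Module F V]
    {G : Type*} (e : (G × ℕ →₀ F) ≃ₗ[F] V) (v : Module.End F V) (x y z w : F)
    (he : ∀ g n, v (e (Finsupp.single (g, n) 1)) = e (Finsupp.single (g, n + 1) 1) +
      (if Even n then x + w else y + z) • e (Finsupp.single (g, n) 1)) :
    ∃ a b : Module.End F V, v = a + b ∧ (a - x • 1) * (a - y • 1) = 0 ∧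
      (b - z • 1) * (b - w • 1) = 0 := by
  let B : Module.Basis (G × ℕ) F V := Finsupp.basisSingleOne.map e
  have hB : ∀ p, B p = e (Finsupp.single p 1) := fun p => by simp [B]
  let a : Module.End F V := B.constr F
    (fun p => if Even p.2 then B (p.1, p.2 + 1) + x • B p else y • B p)
  let b : Module.End F V := B.constr F
    (fun p => if Even p.2 then w • B p else B (p.1, p.2 + 1) + z • B p)
  have ha : ∀ g n, a (B (g, n)) = if Even n then B (g, n + 1) + x • B (g, n) else y • B (g, n) :=
    fun g n => B.constr_basis F _ _
  have hb : ∀ g n, b (B (g, n)) = if Even n then w • B (g, n) else B (g, n + 1) + z • B (g, n) :=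
    fun g n => B.constr_basis F _ _
  refine ⟨a, b, B.ext ?_, B.ext ?_, B.ext ?_⟩ <;> rintro ⟨g, n⟩ <;> by_cases hn : Even n
  · rw [LinearMap.add_apply, ha, hb, hB, hB, he]
    simp only [hn, if_true]
    module
  · rw [LinearMap.add_apply, ha, hb, hB, hB, he]
    simp only [hn, if_false]
    module
  all_goals
    simp only [Module.End.mul_apply, LinearMap.sub_apply, LinearMap.smul_apply,
      Module.End.one_apply, ha, hb, hn, if_true, if_false, map_sub, map_add, map_smul,
      Nat.even_add_one, not_true_eq_false, not_false_eq_true, LinearMap.zero_apply]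
    module

universe uF uV

/-- If `V` contains a family `x` of `dim V` vectors (infinitely many) such that the `x i` and the
`n (x i)` are jointly linearly independent, then `n` is the sum of three endomorphisms annihilated
by prescribed split polynomials of degree two. -/
theorem exists_add_three_of_linearIndependent {F : Type uF} {V I : Type uV} [Field F]
    [AddCommGroup V] [Module F V] [Infinite I] (n : Module.End F V) (x : I → V)
    (hx : LinearIndependent F (Sum.elim x (fun i => n (x i))))
    (hI : Module.rank F V ≤ Cardinal.mk I) (x₁ y₁ x₂ y₂ x₃ y₃ : F) :
    ∃ a₁ a₂ a₃ : Module.End F V, n = a₁ + a₂ + a₃ ∧ (a₁ - x₁ • 1) * (a₁ - y₁ • 1) = 0 ∧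
      (a₂ - x₂ • 1) * (a₂ - y₂ • 1) = 0 ∧ (a₃ - x₃ • 1) * (a₃ - y₃ • 1) = 0 := by
  classical
  obtain ⟨S, b₀, hb₀⟩ := hx.exists_basis_sum
  let b : Module.Basis (I ⊕ (I ⊕ S)) F V := b₀.reindex (Equiv.sumAssoc I I S)
  have hby : ∀ i, n (b (Sum.inl i)) = b (Sum.inr (Sum.inl i)) := by
    intro i
    have h1 := hb₀ (Sum.inl i)
    have h2 := hb₀ (Sum.inr i)
    simp only [Sum.elim_inl, Sum.elim_inr] at h1 h2
    simp [b, h1, h2]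
  have hJ : Cardinal.mk (I ⊕ S) ≤ Cardinal.mk I :=
    (Cardinal.mk_le_of_injective (f := (Sum.inr : I ⊕ S → I ⊕ (I ⊕ S))) Sum.inr_injective).trans
      (b.mk_eq_rank''.le.trans hI)
  obtain ⟨j⟩ := hJ
  obtain ⟨lo, wf, hlo⟩ := exists_wellOrder_injective_upperBounds j
  let idx : I ⊕ (I ⊕ S) → Finset I :=
    Sum.elim (fun i => {i}) (Sum.elim (fun i => {i}) (fun _ => ∅))
  obtain ⟨σ, hσ, hσA⟩ := hlo (fun j => (b.repr (n (b (Sum.inr j)))).support.biUnion idx ∪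
    idx (Sum.inr j))
  -- `n (x i)` sits just above `x i` and below every `x i'` with `i < i'`; the remaining basis
  -- vectors are at the bottom.
  let lev : I ⊕ (I ⊕ S) → WithBot I ×ₗ ℕ :=
    Sum.elim (fun i => toLex (↑i, 0)) (Sum.elim (fun i => toLex (↑i, 1)) (fun _ => toLex (⊥, 0)))
  have hlev : ∀ k i, (∀ i' ∈ idx k, i' < i) → lev k < lev (Sum.inl i) := by
    rintro (k | k | k) i h
    · exact Prod.Lex.toLex_lt_toLex.mpr (Or.inl (WithBot.coe_lt_coe.mpr (h k (by simp [idx]))))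
    · exact Prod.Lex.toLex_lt_toLex.mpr (Or.inl (WithBot.coe_lt_coe.mpr (h k (by simp [idx]))))
    · exact Prod.Lex.toLex_lt_toLex.mpr (Or.inl (WithBot.bot_lt_coe i))
  have hlev' : ∀ i, lev (Sum.inl i) < lev (Sum.inr (Sum.inl i)) := fun i =>
    Prod.Lex.toLex_lt_toLex.mpr (Or.inr ⟨rfl, Nat.zero_lt_one⟩)
  let s : I ⊕ (I ⊕ S) → I ⊕ (I ⊕ S) :=
    Sum.elim (fun i => Sum.inr (Sum.inl i)) (fun j => Sum.inl (σ j))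
  have hs : Function.Injective s := by
    rintro (i | j) (i' | j') h
    · simpa [s] using h
    · simp [s] at h
    · simp [s] at h
    · simpa [s] using hσ (by simpa [s] using h)
  -- `a₁` is `y₁` on the span of the `x i` and `x₁` modulo it, hence quadratic. Its free
  -- off-diagonal part gives `n - a₁` the leading term `x (σ j)`, above everything in `n (b (Sum.inr
  -- j))`.
  let a₁ : Module.End F V := b.constr F (Sum.elim (fun i => y₁ • b (Sum.inl i))
    (fun j => x₁ • b (Sum.inr j) - b (Sum.inl (σ j))))
  have ha₁ : ∀ i, a₁ (b (Sum.inl i)) = y₁ • b (Sum.inl i) := fun i => b.constr_basis F _ _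
  have ha₁' : ∀ j, a₁ (b (Sum.inr j)) = x₁ • b (Sum.inr j) - b (Sum.inl (σ j)) :=
    fun j => b.constr_basis F _ _
  have hj : ∀ j, lev (Sum.inr j) < lev (Sum.inl (σ j)) := fun j =>
    hlev _ _ fun i' hi' => hσA j i' (Finset.mem_union_right _ hi')
  obtain ⟨e, he⟩ := exists_linearEquiv_shift_of_basis b (n - a₁)
    (r := fun k m => lev k < lev m) (InvImage.wf lev wellFounded_lt) s hs
    (by
      rintro (i | j)
      · exact hlev' i
      · exact hj j)
    (by
      rintro (i | j) k hk
      · have h1 : (n - a₁) (b (Sum.inl i)) - b (s (Sum.inl i)) = (-y₁) • b (Sum.inl i) := by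
          simp only [LinearMap.sub_apply, hby, ha₁, s, Sum.elim_inl]
          module
        rw [h1, map_smul, b.repr_self, Finsupp.smul_single] at hk
        rw [Finset.mem_singleton.mp (Finsupp.support_single_subset hk)]
        exact hlev' i
      · have h1 : (n - a₁) (b (Sum.inr j)) - b (s (Sum.inr j)) =
            n (b (Sum.inr j)) - x₁ • b (Sum.inr j) := by
          simp only [LinearMap.sub_apply, ha₁', s, Sum.elim_inr]
          module
        rw [h1, map_sub, map_smul, b.repr_self, Finsupp.smul_single] at hk
        rcases Finset.mem_union.mp (Finsupp.support_sub hk) with hk | hk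
        · exact hlev _ _ fun i' hi' => hσA j i'
            (Finset.mem_union_left _ (Finset.mem_biUnion.mpr ⟨k, hk, hi'⟩))
        · rw [Finset.mem_singleton.mp (Finsupp.support_single_subset hk)]
          exact hj j)
    (fun m => if Even m then x₂ + y₃ else y₂ + x₃)
  obtain ⟨a₂, a₃, h, h₂, h₃⟩ := exists_add_of_shift e (n - a₁) x₂ y₂ x₃ y₃ he
  refine ⟨a₁, a₂, a₃, ?_, b.ext ?_, h₂, h₃⟩
  · rw [add_assoc, ← h, add_sub_cancel]
  · rintro (i | j)
    all_goals
      simp only [Module.End.mul_apply, LinearMap.sub_apply, LinearMap.smul_apply,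
        Module.End.one_apply, ha₁, ha₁', map_sub, map_smul, LinearMap.zero_apply]
      module

/-! ### Scalar endomorphisms under the trace condition -/

/-- The endomorphism of `N × N` given by the two-by-two matrix with rows `(α, β)` and `(γ, δ)`. -/
def blockEnd {F : Type*} (N : Type*) [Field F] [AddCommGroup N] [Module F N] (α β γ δ : F) :
    Module.End F (N × N) :=
  (α • LinearMap.fst F N N + β • LinearMap.snd F N N).prod
    (γ • LinearMap.fst F N N + δ • LinearMap.snd F N N)

theorem blockEnd_apply {F : Type*} {N : Type*} [Field F] [AddCommGroup N] [Module F N]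
    (α β γ δ : F) (m : N × N) :
    blockEnd N α β γ δ m = (α • m.1 + β • m.2, γ • m.1 + δ • m.2) := rfl

/-- The Cayley-Hamilton theorem for block endomorphisms. -/
theorem blockEnd_sub_mul_sub {F : Type*} {N : Type*} [Field F] [AddCommGroup N] [Module F N]
    {α β γ δ x y : F} (ht : α + δ = x + y) (hd : α * δ - β * γ = x * y) :
    (blockEnd N α β γ δ - x • 1) * (blockEnd N α β γ δ - y • 1) = 0 := by
  refine LinearMap.ext fun m => ?_
  simp only [Module.End.mul_apply, LinearMap.sub_apply, LinearMap.smul_apply,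
    Module.End.one_apply, blockEnd_apply, LinearMap.zero_apply]
  refine Prod.ext ?_ ?_
  · have h1 : α * α + β * γ - α * (x + y) + x * y = 0 := by
      rw [← ht, ← hd]
      ring
    have h2 : β * (α + δ - (x + y)) = 0 := by rw [ht, sub_self, mul_zero]
    trans (α * α + β * γ - α * (x + y) + x * y) • m.1 + (β * (α + δ - (x + y))) • m.2
    · simp only [Prod.fst_sub, Prod.snd_sub, Prod.smul_fst, Prod.smul_snd]
      module
    · rw [h1, h2, zero_smul, zero_smul, add_zero, Prod.fst_zero]
  · have h1 : γ * β + δ * δ - δ * (x + y) + x * y = 0 := by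
      rw [← ht, ← hd]
      ring
    have h2 : γ * (α + δ - (x + y)) = 0 := by rw [ht, sub_self, mul_zero]
    trans (γ * β + δ * δ - δ * (x + y) + x * y) • m.2 + (γ * (α + δ - (x + y))) • m.1
    · simp only [Prod.fst_sub, Prod.snd_sub, Prod.smul_fst, Prod.smul_snd]
      module
    · rw [h1, h2, zero_smul, zero_smul, add_zero, Prod.snd_zero]

/-- A scalar endomorphism of `N × N` is the sum of three endomorphisms annihilated by prescribed
split polynomials of degree two as soon as the traces match. -/
theorem exists_smul_one_eq_add_three {F : Type*} (N : Type*) [Field F] [AddCommGroup N]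
    [Module F N] {l x₁ y₁ x₂ y₂ x₃ y₃ : F} (hl : 2 * l = x₁ + y₁ + (x₂ + y₂) + (x₃ + y₃)) :
    ∃ a₁ a₂ a₃ : Module.End F (N × N), l • 1 = a₁ + a₂ + a₃ ∧
      (a₁ - x₁ • 1) * (a₁ - y₁ • 1) = 0 ∧ (a₂ - x₂ • 1) * (a₂ - y₂ • 1) = 0 ∧
      (a₃ - x₃ • 1) * (a₃ - y₃ • 1) = 0 := by
  -- The first two matrices are triangular. The third is what remains: `hl` gives its trace, and the
  -- lower-left entry of the second is chosen to make its determinant `x₃ * y₃`.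
  refine ⟨blockEnd N x₁ 1 0 y₁,
    blockEnd N y₂ 0 ((l - x₁ - y₂) * (l - y₁ - x₂) - x₃ * y₃) x₂,
    blockEnd N (l - x₁ - y₂) (-1) (-((l - x₁ - y₂) * (l - y₁ - x₂) - x₃ * y₃)) (l - y₁ - x₂),
    LinearMap.ext fun m => ?_, blockEnd_sub_mul_sub rfl (by ring),
    blockEnd_sub_mul_sub (add_comm _ _) (by ring),
    blockEnd_sub_mul_sub (by linear_combination hl) (by ring)⟩
  simp only [LinearMap.add_apply, LinearMap.smul_apply, Module.End.one_apply, blockEnd_apply]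
  refine Prod.ext ?_ ?_
  · simp only [Prod.fst_add, Prod.smul_fst]
    module
  · simp only [Prod.snd_add, Prod.smul_snd]
    module

/-- An infinite-dimensional vector space is a direct square. -/
theorem exists_linearEquiv_prod_self {F : Type uF} {K : Type uV} [Field F] [AddCommGroup K]
    [Module F K] (hK : ¬ FiniteDimensional F K) :
    ∃ (ι : Type uV), Nonempty (K ≃ₗ[F] (ι →₀ F) × (ι →₀ F)) := by
  let b := Module.Basis.ofVectorSpace F K
  have : Infinite (Module.Basis.ofVectorSpaceIndex F K) := by
    by_contra h
    rw [not_infinite_iff_finite] at h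
    exact hK (Module.Finite.of_basis b)
  obtain ⟨e⟩ : Nonempty (Module.Basis.ofVectorSpaceIndex F K ≃
      Module.Basis.ofVectorSpaceIndex F K ⊕ Module.Basis.ofVectorSpaceIndex F K) := by
    rw [← Cardinal.eq, Cardinal.mk_sum, Cardinal.lift_id,
      Cardinal.add_eq_self (Cardinal.aleph0_le_mk _)]
  exact ⟨_, ⟨(b.reindex e).repr.trans (Finsupp.sumFinsuppLEquivProdFinsupp F)⟩⟩

/-! ### Transport and gluing of sums -/

theorem IsEndSum.map {F V W : Type*} [Field F] [AddCommGroup V] [Module F V] [AddCommGroup W]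
    [Module F W] {k : ℕ} {p : Fin k → F[X]} {u : Module.End F V} (h : IsEndSum p u)
    (f : Module.End F V →ₐ[F] Module.End F W) : IsEndSum p (f u) := by
  obtain ⟨a, rfl, ha⟩ := h
  refine ⟨fun i => f (a i), map_sum _ _ _, fun i => ?_⟩
  rw [aeval_algHom_apply, ha, map_zero]

theorem IsEndSum.smul_one_of_linearEquiv {F V W : Type*} [Field F] [AddCommGroup V] [Module F V]
    [AddCommGroup W] [Module F W] {k : ℕ} {p : Fin k → F[X]} {l : F}
    (h : IsEndSum p (l • 1 : Module.End F V)) (e : W ≃ₗ[F] V) :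
    IsEndSum p (l • 1 : Module.End F W) := by
  have := h.map (AlgHomClass.toAlgHom (e.symm.conjAlgEquiv F))
  rwa [map_smul, map_one] at this

/-- An endomorphism that leaves two complementary subspaces invariant is a `(p₁, …, pₙ)`-sum if it
induces `(p₁, …, pₙ)`-sums on them. -/
theorem IsEndSum.of_isCompl {F V : Type*} [Field F] [AddCommGroup V] [Module F V] {k : ℕ}
    {p : Fin k → F[X]} {u : Module.End F V} {A B : Submodule F V} (hAB : IsCompl A B)
    {c : Module.End F A} {d : Module.End F B} (hc : ∀ m : A, u m = c m) (hd : ∀ m : B, u m = d m)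
    (h₁ : IsEndSum p c) (h₂ : IsEndSum p d) : IsEndSum p u := by
  obtain ⟨a, rfl, ha⟩ := h₁
  obtain ⟨b, rfl, hb⟩ := h₂
  let e := Submodule.prodEquivOfIsCompl A B hAB
  -- Block-diagonal gluing is an algebra morphism, so polynomial identities hold once they hold on
  -- both blocks.
  let f : (Module.End F A × Module.End F B) →ₐ[F] Module.End F V :=
    (e.conjAlgEquiv F).toAlgHom.comp (LinearMap.prodMapAlgHom F A B)
  refine ⟨fun i => f (a i, b i), ?_, fun i => ?_⟩
  · rw [← map_sum]
    have hf : ∀ (c : Module.End F A) (d : Module.End F B) m, f (c, d) (e m) = c m.1 + d m.2 := by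
      intro c d m
      simp [f, e, LinearEquiv.conjAlgEquiv_apply]
    refine LinearMap.ext fun v => ?_
    obtain ⟨m, rfl⟩ := e.surjective v
    rw [show ∑ i, (a i, b i) = (∑ i, a i, ∑ i, b i) from 
      Prod.ext Prod.fst_sum Prod.snd_sum, hf,
      ← hc, ← hd, ← map_add]
    rfl
  · rw [aeval_algHom_apply, aeval_prod_apply, ha, hb]
    exact map_zero f

theorem isEndSum_three {F V : Type*} [Field F] [AddCommGroup V] [Module F V]
    {p₁ p₂ p₃ : F[X]} {a₁ a₂ a₃ : Module.End F V} (h₁ : aeval a₁ p₁ = 0) (h₂ : aeval a₂ p₂ = 0)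
    (h₃ : aeval a₃ p₃ = 0) : IsEndSum ![p₁, p₂, p₃] (a₁ + a₂ + a₃) := by
  refine ⟨![a₁, a₂, a₃], by simp [Fin.sum_univ_three], fun k => ?_⟩
  fin_cases k <;> assumption

theorem aeval_eq_zero_of_sub_mul_sub {F V : Type*} [Field F] [AddCommGroup V] [Module F V]
    {p : F[X]} {c x y : F} (hp : p = C c * ((X - C x) * (X - C y))) {a : Module.End F V}
    (ha : (a - x • 1) * (a - y • 1) = 0) : aeval a p = 0 := by
  simp only [← Algebra.algebraMap_eq_smul_one] at ha
  simp only [hp, map_mul, map_sub, aeval_X, aeval_C, ha, mul_zero]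

theorem Polynomial.Splits.exists_eq_of_degree_eq_two {F : Type*} [Field F] {p : F[X]}
    (hs : p.Splits) (hd : p.degree = 2) :
    ∃ x y : F, p = C p.leadingCoeff * ((X - C x) * (X - C y)) ∧ polyTrace p = x + y := by
  have hn : p.natDegree = 2 := natDegree_eq_of_degree_eq_some hd
  obtain ⟨x, y, hxy⟩ := Multiset.card_eq_two.mp (hs.natDegree_eq_card_roots.symm.trans hn)
  have hp := hs.eq_prod_roots
  rw [hxy] at hp
  simp only [Multiset.insert_eq_cons, Multiset.map_cons, Multiset.map_singleton,
    Multiset.prod_cons, Multiset.prod_singleton] at hp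
  refine ⟨x, y, hp, ?_⟩
  have hl : p.leadingCoeff ≠ 0 := leadingCoeff_ne_zero.mpr (by rintro rfl; simp at hd)
  have h1 : C p.leadingCoeff⁻¹ * p = X ^ 2 - C (x + y) * X + C (x * y) := by
    nth_rw 2 [hp]
    rw [← mul_assoc, ← C_mul, inv_mul_cancel₀ hl, C_1, one_mul, C_add, C_mul]
    ring
  rw [polyTrace, h1, hn]
  simp [coeff_C, coeff_X_pow]

/-! ### Splitting off part of the kernel -/

/-- If the rank of `n` is infinite and less than the dimension, then the space splits into a
subspace of the kernel of `n` and a subspace with dimension the rank of `n`, in which there are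
as many vectors `x i` such that the `x i` and the `n (x i)` are jointly linearly independent. -/
theorem exists_isCompl_of_rank_lt {F : Type uF} {V : Type uV} [Field F] [AddCommGroup V]
    [Module F V] (n : Module.End F V) (hn : LinearMap.rank n < Module.rank F V)
    (hn' : ¬ FiniteDimensional F (LinearMap.range n)) :
    ∃ A B : Submodule F V, IsCompl A B ∧ LinearMap.range n ≤ A ∧ B ≤ LinearMap.ker n ∧
      ¬ FiniteDimensional F B ∧ ∃ (I : Type uV) (_ : Infinite I) (x : I → A),
        Module.rank F A ≤ Cardinal.mk I ∧
        LinearIndependent F (Sum.elim (fun i => (x i : V)) (fun i => n (x i))) := by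
  let β := Module.Basis.ofVectorSpace F (LinearMap.range n)
  let I := Module.Basis.ofVectorSpaceIndex F (LinearMap.range n)
  have hI : Infinite I := by
    by_contra h
    rw [not_infinite_iff_finite] at h
    exact hn' (Module.Finite.of_basis β)
  have hω : Cardinal.aleph0 ≤ Cardinal.mk I := Cardinal.aleph0_le_mk I
  have hrank : LinearMap.rank n = Cardinal.mk I := β.mk_eq_rank''.symm
  choose w hw using fun i => (β i).2
  have hlift : ∀ v, ∃ s ∈ Submodule.span F (Set.range w), n s = n v := by
    intro v
    have h1 : (Submodule.span F (Set.range w)).map n = LinearMap.range n := by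
      rw [Submodule.map_span, ← Set.range_comp]
      have h2 : (n ∘ w : I → V) = (LinearMap.range n).subtype ∘ β := funext hw
      rw [h2, Set.range_comp, ← Submodule.map_span, β.span_eq, Submodule.map_subtype_top]
    have h3 : n v ∈ (Submodule.span F (Set.range w)).map n :=
      h1.symm ▸ LinearMap.mem_range_self n v
    exact Submodule.mem_map.mp h3
  have hspan : ∀ f : I → V, Module.rank F (Submodule.span F (Set.range f)) ≤ Cardinal.mk I :=
    fun f => (rank_span_le _).trans Cardinal.mk_range_le
  have hsup : ∀ P Q : Submodule F V, Module.rank F P ≤ Cardinal.mk I →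
      Module.rank F Q ≤ Cardinal.mk I → Module.rank F (P ⊔ Q : Submodule F V) ≤ Cardinal.mk I :=
    fun P Q hP hQ => (Submodule.rank_add_le_rank_add_rank P Q).trans
      ((add_le_add hP hQ).trans (Cardinal.add_eq_self hω).le)
  let S : Submodule F V := Submodule.span F (Set.range w) ⊔ LinearMap.range n
  have hS : Module.rank F S ≤ Cardinal.mk I := hsup _ _ (hspan w) hrank.le
  have hQ : Cardinal.mk I ≤ Module.rank F (V ⧸ S) := by
    by_contra! h
    refine absurd hn (not_lt.mpr ?_)
    rw [hrank, ← Submodule.rank_quotient_add_rank S]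
    exact (add_le_add h.le hS).trans (Cardinal.add_eq_self hω).le
  let γ := Module.Basis.ofVectorSpace F (V ⧸ S)
  rw [← γ.mk_eq_rank''] at hQ
  obtain ⟨j⟩ := hQ
  -- The lifts `w` span a supplement of the kernel inside `S`, so every class modulo `S` has a
  -- representative in the kernel.
  have hk : ∀ i, ∃ k ∈ LinearMap.ker n, S.mkQ k = γ (j i) := by
    intro i
    obtain ⟨v, hv⟩ := S.mkQ_surjective (γ (j i))
    obtain ⟨s, hs, hsv⟩ := hlift v
    refine ⟨v - s, by rw [LinearMap.mem_ker, map_sub, hsv, sub_self], ?_⟩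
    have : S.mkQ s = 0 := by
      rw [Submodule.mkQ_apply, Submodule.Quotient.mk_eq_zero]
      exact Submodule.mem_sup_left hs
    rw [map_sub, this, sub_zero, hv]
  choose k hk hkγ using hk
  let A : Submodule F V := S ⊔ Submodule.span F (Set.range k)
  have hSA : S ≤ A := le_sup_left
  have hA : Module.rank F A ≤ Cardinal.mk I := hsup _ _ hS (hspan k)
  have hwS : ∀ i, w i ∈ S := fun i => Submodule.mem_sup_left (Submodule.subset_span ⟨i, rfl⟩)
  have hcod : Codisjoint (LinearMap.ker n) A := by
    rw [codisjoint_iff, eq_top_iff]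
    intro v _
    obtain ⟨s, hs, hsv⟩ := hlift v
    refine Submodule.mem_sup.mpr ⟨v - s, by rw [LinearMap.mem_ker, map_sub, hsv, sub_self], s,
      hSA (Submodule.mem_sup_left hs), sub_add_cancel _ _⟩
  obtain ⟨B, hB, hBA⟩ := hcod.exists_isCompl
  -- Take `x i = w i + k i`: the images `β i` are independent in `S`, while the `x i` are
  -- independent modulo `S`.
  refine ⟨A, B, hBA.symm, le_sup_right.trans hSA, hB, fun hfin => ?_, I, hI,
    fun i => ⟨w i + k i, A.add_mem (hSA (hwS i))
      (Submodule.mem_sup_right (Submodule.subset_span ⟨i, rfl⟩))⟩, hA, ?_⟩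
  · refine absurd hn (not_lt.mpr ?_)
    rw [hrank, ← rank_top F V, ← hBA.sup_eq_top]
    exact hsup _ _ ((Module.rank_lt_aleph0 F B).le.trans hω) hA
  · have hnx : ∀ i, n (w i + k i) = β i := by
      intro i
      rw [map_add, hw, LinearMap.mem_ker.mp (hk i), add_zero]
    have hf : LinearIndependent F
        (fun i => (⟨β i, Submodule.mem_sup_right (β i).2⟩ : S)) :=
      LinearIndependent.of_comp S.subtype
        (β.linearIndependent.map' (LinearMap.range n).subtype (Submodule.ker_subtype _))
    have hg : LinearIndependent F
        (Submodule.Quotient.mk (p := S) ∘ fun i => w i + k i) := by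
      have : (Submodule.Quotient.mk (p := S) ∘ fun i => w i + k i) = γ ∘ j := by
        funext i
        have h0 : S.mkQ (w i) = 0 := by
          rw [Submodule.mkQ_apply, Submodule.Quotient.mk_eq_zero]
          exact hwS i
        have h1 : S.mkQ (w i + k i) = γ (j i) := by rw [map_add, h0, zero_add, hkγ]
        exact h1
      rw [this]
      exact γ.linearIndependent.comp j j.injective
    have hfun : Sum.elim (fun i => w i + k i) (fun i => n (w i + k i)) =
        Sum.elim (fun i => (β i : V)) (fun i => w i + k i) ∘ Sum.swap := by
      funext i
      rcases i with i | i
      · rfl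
      · exact hnx i
    exact hfun ▸ (LinearIndependent.sumElim_of_quotient hf _ hg).comp Sum.swap
      Sum.swap_leftInverse.injective

/-! ### The main theorem -/

theorem mainTheorem4 {F : Type*} {V : Type*} [Field F] [AddCommGroup V] [Module F V]
    (hV : ¬ FiniteDimensional F V)
    (p₁ p₂ p₃ : F[X])
    (hs₁ : p₁.Splits) (hs₂ : p₂.Splits) (hs₃ : p₃.Splits)
    (hd₁ : p₁.degree = 2) (hd₂ : p₂.degree = 2) (hd₃ : p₃.degree = 2)
    (u : Module.End F V) (l : F)
    (hl : IsDominantEigenvalue u l)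
    (hrank : ¬ FiniteDimensional F (LinearMap.range (u - l • LinearMap.id)))
    (h : IsScalarSum ![p₁, p₂, p₃] l ∨
      2 * l = polyTrace p₁ + polyTrace p₂ + polyTrace p₃) :
    IsEndSum ![p₁, p₂, p₃] u := by
  obtain ⟨x₁, y₁, hp₁, ht₁⟩ := hs₁.exists_eq_of_degree_eq_two hd₁
  obtain ⟨x₂, y₂, hp₂, ht₂⟩ := hs₂.exists_eq_of_degree_eq_two hd₂
  obtain ⟨x₃, y₃, hp₃, ht₃⟩ := hs₃.exists_eq_of_degree_eq_two hd₃
  obtain ⟨A, B, hAB, hA, hB, hBinf, I, hI, x, hIA, hx⟩ :=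
    exists_isCompl_of_rank_lt (u - l • LinearMap.id) hl hrank
  let n : Module.End F A :=
    (u - l • LinearMap.id).restrict fun v _ => hA (LinearMap.mem_range_self _ v)
  have hn : ∀ m : A, (n m : V) = u m - l • (m : V) := fun m => rfl
  refine IsEndSum.of_isCompl hAB (c := n + l • 1) (d := l • 1) (fun m => ?_) (fun m => ?_) ?_ ?_
  · simp [hn]
  · have := LinearMap.mem_ker.mp (hB m.2)
    simpa [sub_eq_zero] using this
  · have hxn : LinearIndependent F (Sum.elim x (fun i => n (x i))) := by
      have hfun : A.subtype ∘ Sum.elim x (fun i => n (x i)) = Sum.elim (fun i => (x i : V))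
          (fun i => (u - l • LinearMap.id : Module.End F V) (x i)) := by
        funext i
        rcases i with i | i <;> rfl
      exact LinearIndependent.of_comp A.subtype (hfun ▸ hx)
    -- The scalar `l` is absorbed into the first summand, whose roots are therefore shifted by `-l`.
    obtain ⟨a₁, a₂, a₃, hn, h₁, h₂, h₃⟩ :=
      exists_add_three_of_linearIndependent n x hxn hIA (x₁ - l) (y₁ - l) x₂ y₂ x₃ y₃
    have h₁' : (a₁ + l • 1 - x₁ • 1) * (a₁ + l • 1 - y₁ • 1) = 0 := by
      rw [← h₁]
      congr 1 <;> module
    rw [hn, show a₁ + a₂ + a₃ + l • 1 = (a₁ + l • 1) + a₂ + a₃ by abel]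
    exact isEndSum_three (aeval_eq_zero_of_sub_mul_sub hp₁ h₁')
      (aeval_eq_zero_of_sub_mul_sub hp₂ h₂) (aeval_eq_zero_of_sub_mul_sub hp₃ h₃)
  · rcases h with ⟨z, rfl, hz⟩ | h
    · refine ⟨fun i => algebraMap F _ (z i), ?_, fun i => ?_⟩
      · rw [← map_sum, Algebra.algebraMap_eq_smul_one]
      · rw [aeval_algebraMap_apply, coe_aeval_eq_eval, hz, map_zero]
    · rw [ht₁, ht₂, ht₃] at h
      obtain ⟨ι, ⟨e⟩⟩ := exists_linearEquiv_prod_self hBinf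
      obtain ⟨a₁, a₂, a₃, ha, h₁, h₂, h₃⟩ := exists_smul_one_eq_add_three (ι →₀ F) h
      have h₁' := aeval_eq_zero_of_sub_mul_sub hp₁ h₁
      have h₂' := aeval_eq_zero_of_sub_mul_sub hp₂ h₂
      have h₃' := aeval_eq_zero_of_sub_mul_sub hp₃ h₃
      have hsum := isEndSum_three h₁' h₂' h₃'
      rw [← ha] at hsum
      exact hsum.smul_one_of_linearEquiv e
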